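/- Let $k$ be a field of characteristic zero and $V$ a $k$-vector space with basis $(b_i)_{i\in X}$. Let $H=S(V)$ be the polynomial (symmetric) algebra over $V$, equipped with a coproduct $\Delta$, with counit the projection $S(V)\to S^0(V)=k$, which makes it a Hopf algebra with antipode $S$. Put $\overline\Delta(c)=\Delta(c)-c\otimes 1-1\otimes c$, and let $\overline\Delta^{[1]}=\mathrm{id}$, $\overline\Delta^{[n+1]}=(\overline\Delta\otimes \mathrm{id}^{\otimes n-1})\circ\overline\Delta^{[n]}$. Assume that $H$ is conilpotent (every $c$ in the kernel of the counit satisfies $\overline\Delta^{[n]}(c)=0$ for some $n\ge 1$) and right-handed ($\overline\Delta(V)\subset V\otimes S(V)$). For a finite multiset $I$ over $X$ write $b_I=\prod_{j\in I}b_j$, and define the structure coefficients $\lambda^{i;i_0}_I\in k$ by $$\overline\Delta(b_i)=\sum_{i_0\in X,\ I\neq\emptyset}\lambda^{i;i_0}_I\; b_{i_0}\otimes b_I .$$ The set $\mathcal T_i$ of decorated rooted trees associated to $b_i$ is defined recursively: its elements are the one-vertex tree $\bullet_i$, and the trees $B^+_{(i;i_0)}\big((T_j)_{j\in I}\big)$,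 where $i_0\in X$, $I$ is a nonempty finite multiset over $X$ and $(T_j)_{j\in I}$ is a family of trees $T_j\in\mathcal T_j$, one for each occurrence of an element in $I$ (the occurrences of a repeated element are distinguished). For $T\in\mathcal T_i$, the length $l(T)$ is the number of vertices of $T$, and the coefficient $\lambda(T)\in k$ and the $b$-value $v(T)\in S(V)$ are given by $\lambda(\bullet_i)=1$, $v(\bullet_i)=b_i$, and, for $T=B^+_{(i;i_0)}\big((T_j)_{j\in I}\big)$, $$\lambda(T)=\lambda^{i;i_0}_I\prod_{j\in I}\lambda(T_j),\qquad v(T)=b_{i_0}\prod_{j\in I}v(T_j).$$ Then, for every $i\in X$, the antipode is given by the cancellation free formula, in which each tree of $\mathcal T_i$ appears exactly once, $$S(b_i)=\sum_{T\in\mathcal T_i}(-1)^{l(T)}\lambda(T)\,v(T),$$ in the following sense. 1. For every $n$, only finitely many $T\in\mathcal T_i$ with $l(T)\le n$ have $\lambda(T)\neq0$. 2. There is an $N$ such that $S(b_i)=\sum_{T\in\mathcal T_i,\ l(T)\le n}(-1)^{l(T)}\lambda(T)\,v(T)$ for all $n\ge N$. 3. If only finitely many $T\in\mathcal T_i$ have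 $\lambda(T)\neq 0$, the formula holds as an ordinary finite sum over all of $\mathcal T_i$. 4. The hypothesis of 3 holds whenever there is a function $\deg:X\to\mathbb N$ such that $\lambda^{p;p_0}_I\neq0$ implies $\deg j<\deg p$ for all $j\in I$ (for instance when $H$ is graded with each $b_i$ homogeneous of positive degree). -/

import Mathlib

open scoped TensorProduct

noncomputable section

namespace PreLieForest

section Hopf

variable {k V H X : Type*} [Field k] [AddCommGroup V] [Module k V] [CommRing H]

/-- The reduced coproduct `c ↦ Δ c - c ⊗ 1 - 1 ⊗ c`. -/
def reducedComul (k H : Type*) [Field k] [CommRing H] [Bialgebra k H] : H →ₗ[k] H ⊗[k] H :=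
  Coalgebra.comul - (TensorProduct.mk k H H).flip 1 - TensorProduct.mk k H H 1

/-- `iterReducedComul k H n` is the iterated reduced coproduct with values in the tensor power
`H^{⊗ (n + 1)}`: it is the identity for `n = 0`, the reduced coproduct for `n = 1`, and in general
`(Δ' ⊗ id ⊗ ⋯ ⊗ id) ∘ ⋯ ∘ (Δ' ⊗ id) ∘ Δ'` with `n` factors `Δ'`, the reduced coproduct. -/
def iterReducedComul (k H : Type*) [Field k] [CommRing H] [Bialgebra k H] :
    (n : ℕ) → H →ₗ[k] ⨂[k]^(n + 1) H
  | 0 => (PiTensorProduct.subsingletonEquiv (R := k) (s := fun _ : Fin 1 => H) (0 : Fin 1)).symm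
  | n + 1 =>
      (TensorPower.mulEquiv (R := k) (M := H) (n := n + 1) (m := 1)).toLinearMap ∘ₗ
        TensorProduct.map (iterReducedComul k H n) (iterReducedComul k H 0) ∘ₗ reducedComul k H

/-- Every element of the augmentation ideal is killed by some iterated reduced coproduct. -/
def IsConilpotent (k H : Type*) [Field k] [CommRing H] [Bialgebra k H] : Prop :=
  ∀ c : H, Coalgebra.counit (R := k) c = 0 → ∃ n : ℕ, iterReducedComul k H n c = 0

variable [Bialgebra k H]

/-- The commutative bialgebra `H` is, as an algebra, the polynomial (symmetric) algebra `S(V)`,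
where `ι : V → H` is the inclusion of the generators; its counit is the projection of `S(V)` onto
`S⁰(V) = k`; and its coproduct is right-handed: the reduced coproduct maps `V` into `V ⊗ S(V)`. -/
structure IsRightHandedPolynomial (ι : V →ₗ[k] H) : Prop where
  isSymmetricAlgebra : IsSymmetricAlgebra ι
  counit_ι : ∀ v : V, Coalgebra.counit (R := k) (ι v) = 0
  rightHanded : ∀ v : V, reducedComul k H (ι v) ∈ LinearMap.range (ι.rTensor H)

/-- The basis of `S(V)` formed by the monomials in the elements of the basis `b` of `V`. -/
def monomialBasis {ι : V →ₗ[k] H} (hι : IsSymmetricAlgebra ι) (b : Module.Basis X k V) :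
    Module.Basis (X →₀ ℕ) k H :=
  b.symmetricAlgebra.map hι.equiv.toLinearEquiv

/-- The basis element indexed by a multiset `I` is the monomial `b_I = ∏_{i ∈ I} b_i`. -/
theorem monomialBasis_toFinsupp [DecidableEq X] {ι : V →ₗ[k] H} (hι : IsSymmetricAlgebra ι)
    (b : Module.Basis X k V) (I : Multiset X) :
    monomialBasis hι b (Multiset.toFinsupp I) = (I.map fun i => ι (b i)).prod := by
  have key : ∀ p : MvPolynomial X k,
      hι.equiv ((SymmetricAlgebra.equivMvPolynomial b).symm p) =
        MvPolynomial.aeval (fun i => ι (b i)) p := by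
    intro p
    have : (hι.equiv.toAlgHom.comp (SymmetricAlgebra.equivMvPolynomial b).symm.toAlgHom) =
        MvPolynomial.aeval (fun i => ι (b i)) := by
      ext i
      simp
    exact congrArg (fun f => f p) this
  have h1 : monomialBasis hι b (Multiset.toFinsupp I) =
      hι.equiv ((SymmetricAlgebra.equivMvPolynomial b).symm
        (MvPolynomial.monomial (Multiset.toFinsupp I) (1 : k))) := by
    simp [monomialBasis, Module.Basis.symmetricAlgebra]
  rw [h1, key, MvPolynomial.aeval_monomial, map_one, one_mul, Finset.prod_multiset_map_count,
    Finsupp.prod, Multiset.toFinsupp_support]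
  simp

/-- The structure coefficient `λ^{i;i₀}_I`: the coefficient of `b_{i₀} ⊗ b_I` in the reduced
coproduct of `b_i`. -/
def structureCoeff [DecidableEq X] {ι : V →ₗ[k] H} (hι : IsSymmetricAlgebra ι)
    (b : Module.Basis X k V) (i i₀ : X) (I : Multiset X) : k :=
  ((monomialBasis hι b).tensorProduct (monomialBasis hι b)).repr (reducedComul k H (ι (b i)))
    (Finsupp.single i₀ 1, Multiset.toFinsupp I)

end Hopf

/-- `DecTree X i` is the set of decorated rooted trees associated to `i`. A tree is either a
single vertex decorated by `i`, or a root decorated by a pair `(i; i₀)` on which one grafts a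
forest `∏_{j ∈ I} T_j`, where `I` is a nonempty multiset and `T_j` is a tree associated to `j`, for
each occurrence `j` of an element in `I`. So the forests on `I` are the families `(T_j)` indexed by
the occurrences in `I`: branches are not ordered, but the occurrences of a repeated element of `I`
are told apart, as the factors of the monomial `b_I` are when its coproduct is expanded. -/
inductive DecTree (X : Type*) [DecidableEq X] : X → Type _
  | leaf (i : X) : DecTree X i
  | node (i i₀ : X) (I : Multiset X) (hI : I ≠ 0) (T : (j : I.ToType) → DecTree X j.1) :
      DecTree X i

namespace DecTree

variable {X : Type*} [DecidableEq X]

/-- The length `l(T)`: the number of vertices. -/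
def length : {i : X} → DecTree X i → ℕ
  | _, leaf _ => 1
  | _, node _ _ _ _ T => 1 + ∑ j, (T j).length

/-- The coefficient `λ(T)`: the product of the structure coefficients over the internal
vertices. -/
def coeff {k : Type*} [CommSemiring k] (lam : X → X → Multiset X → k) :
    {i : X} → DecTree X i → k
  | _, leaf _ => 1
  | _, node i i₀ I _ T => lam i i₀ I * ∏ j, (T j).coeff lam

/-- The value `v(T)`: the product over all vertices of the elements `β j`, where `j` is the
decoration of a leaf, and the second component of the decoration of an internal vertex. -/
def value {H : Type*} [CommSemiring H] (β : X → H) : {i : X} → DecTree X i → H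
  | _, leaf i => β i
  | _, node _ i₀ _ _ T => β i₀ * ∏ j, (T j).value β

end DecTree

section Formula

variable {k V H X : Type*} [Field k] [AddCommGroup V] [Module k V] [CommRing H] [Bialgebra k H]
  [DecidableEq X]

/-- The coefficient `λ(T)` with respect to the basis `b` of `V`. -/
def treeCoeff {ι : V →ₗ[k] H} (hι : IsSymmetricAlgebra ι) (b : Module.Basis X k V) {i : X}
    (T : DecTree X i) : k :=
  T.coeff (structureCoeff hι b)

/-- The term `(-1)^{l(T)} λ(T) v(T)` of the forest formula. -/
def treeTerm {ι : V →ₗ[k] H} (hι : IsSymmetricAlgebra ι) (b : Module.Basis X k V) {i : X}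
    (T : DecTree X i) : H :=
  ((-1) ^ T.length * treeCoeff hι b T) • T.value (fun j => ι (b j))

end Formula

end PreLieForest

end

/-! Since `H` is commutative, `S` is an algebra morphism, and `id * S = ε` evaluated at a generator
gives `S(b_i) = -(b_i + ∑ λ b_{i₀} ∏_{j ∈ I} S(b_j))` (`antipode_eq_neg_sum`). Unfolding this need
not terminate, so a variable `t` controls it: the morphism `b_j ↦ t b_j` (`scaling`) sends `S(b_i)`
to a polynomial `q_i` with `q_i = -t (b_i + ∑ λ b_{i₀} ∏ q_j)`. Trees counted by `(-t)^{l(T)}` obey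
the same recursion, which determines the solution modulo each `t^d` because of the factor `t`
(`X_pow_dvd_sub_genPoly`). As `q_i` is a polynomial, coefficients beyond its degree vanish, and `t =
1` gives the stationary sum. -/

namespace PreLieForest

open Polynomial

/-! ### Trees of bounded height and their generating polynomials -/

namespace DecTree

variable {X : Type*} [DecidableEq X]

theorem length_pos {i : X} (T : DecTree X i) : 0 < T.length := by
  cases T <;> simp only [length] <;> omega

theorem length_lt_of_node {i i₀ : X} {I : Multiset X} (hI : I ≠ 0)
    (T : (j : I.ToType) → DecTree X j.1) (j : I.ToType) :
    (T j).length < (node i i₀ I hI T).length := by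
  have := Finset.single_le_sum (f := fun j => (T j).length) (fun _ _ => Nat.zero_le _)
    (Finset.mem_univ j)
  simp only [length] at this ⊢
  omega

/-- The embedding of the set of data defining a tree which is not a single vertex. -/
def nodeEmbedding (i : X) :
    (Σ p : X × {I : Multiset X // I ≠ 0}, (j : p.2.1.ToType) → DecTree X j.1) ↪ DecTree X i where
  toFun t := node i t.1.1 t.1.2.1 t.1.2.2 t.2
  inj' := by
    rintro ⟨⟨a, I, hI⟩, T⟩ ⟨⟨a', I', hI'⟩, T'⟩ h
    simp only [node.injEq] at h
    obtain ⟨rfl, rfl, h⟩ := h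
    obtain rfl := eq_of_heq h
    rfl

open scoped Classical in
/-- The trees with at most `d` generations of vertices, the decorations and branchings
of which are taken in `s`. -/
noncomputable def ofHeight (s : X → Finset (X × {I : Multiset X // I ≠ 0})) :
    ℕ → (i : X) → Finset (DecTree X i)
  | 0, _ => ∅
  | d + 1, i =>
      Finset.cons (leaf i)
        (((s i).sigma fun p => Fintype.piFinset fun j : p.2.1.ToType => ofHeight s d j.1).map
          (nodeEmbedding i))
        (by simp [nodeEmbedding])

variable (s : X → Finset (X × {I : Multiset X // I ≠ 0}))

theorem leaf_mem_ofHeight (d : ℕ) (i : X) : leaf i ∈ ofHeight s (d + 1) i := by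
  simp [ofHeight]

open scoped Classical in
theorem node_mem_ofHeight {d : ℕ} {i i₀ : X} {I : Multiset X} {hI : I ≠ 0}
    {T : (j : I.ToType) → DecTree X j.1} (hs : (i₀, ⟨I, hI⟩) ∈ s i)
    (hT : ∀ j, T j ∈ ofHeight s d j.1) : node i i₀ I hI T ∈ ofHeight s (d + 1) i := by
  rw [ofHeight, Finset.mem_cons]
  refine Or.inr (Finset.mem_map.2 ⟨⟨(i₀, ⟨I, hI⟩), T⟩, ?_, rfl⟩)
  exact Finset.mem_sigma.2 ⟨hs, Fintype.mem_piFinset.2 hT⟩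

open scoped Classical in
theorem sum_ofHeight_succ {M : Type*} [AddCommMonoid M] (d : ℕ) (i : X) (f : DecTree X i → M) :
    ∑ T ∈ ofHeight s (d + 1) i, f T = f (leaf i) + ∑ p ∈ s i,
      ∑ T ∈ Fintype.piFinset fun j : p.2.1.ToType => ofHeight s d j.1,
        f (node i p.1 p.2.1 p.2.2 T) := by
  rw [ofHeight, Finset.sum_cons, Finset.sum_map, Finset.sum_sigma]
  rfl

variable {s} in
-- The height is at most the number of vertices, and a nonzero product of coefficients forces every
-- internal vertex to be decorated from `s`.
theorem mem_ofHeight_of_length_le {k : Type*} [Field k] {lam : X → X → Multiset X → k}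
    (hs : ∀ i i₀ I, lam i i₀ I.1 ≠ 0 → (i₀, I) ∈ s i) {i : X} (T : DecTree X i)
    (hT : T.coeff lam ≠ 0) {d : ℕ} (hd : T.length ≤ d) : T ∈ ofHeight s d i := by
  induction T generalizing d with
  | leaf i =>
    obtain ⟨d, rfl⟩ := Nat.exists_eq_add_of_le' hd
    exact leaf_mem_ofHeight s d i
  | node i i₀ I hI T ih =>
    obtain ⟨d, rfl⟩ := Nat.exists_eq_add_of_le' ((length_pos _).trans_le hd)
    simp only [coeff, mul_ne_zero_iff, Finset.prod_ne_zero_iff] at hT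
    refine node_mem_ofHeight s (hs _ _ ⟨I, hI⟩ hT.1) fun j => ih j (hT.2 j (Finset.mem_univ j)) ?_
    have := length_lt_of_node (i := i) (i₀ := i₀) hI T j
    omega

variable {s} in
-- The degree drops strictly from a vertex to its children, which bounds the height.
theorem mem_ofHeight_of_deg_lt {k : Type*} [Field k] {lam : X → X → Multiset X → k}
    (hs : ∀ i i₀ I, lam i i₀ I.1 ≠ 0 → (i₀, I) ∈ s i) {deg : X → ℕ}
    (hdeg : ∀ p p₀ I, lam p p₀ I ≠ 0 → ∀ j ∈ I, deg j < deg p) {i : X} (T : DecTree X i)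
    (hT : T.coeff lam ≠ 0) {d : ℕ} (hd : deg i < d) : T ∈ ofHeight s d i := by
  induction T generalizing d with
  | leaf i =>
    obtain ⟨d, rfl⟩ := Nat.exists_eq_add_of_le' (Nat.one_le_of_lt hd)
    exact leaf_mem_ofHeight s d i
  | node i i₀ I hI T ih =>
    obtain ⟨d, rfl⟩ := Nat.exists_eq_add_of_le' (Nat.one_le_of_lt hd)
    simp only [coeff, mul_ne_zero_iff, Finset.prod_ne_zero_iff] at hT
    refine node_mem_ofHeight s (hs _ _ ⟨I, hI⟩ hT.1) fun j => ih j (hT.2 j (Finset.mem_univ j)) ?_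
    have := hdeg _ _ _ hT.1 j.1 (Multiset.coe_mem)
    omega

theorem C_smul_mul_prod_mul_X_pow {k H κ : Type*} [Fintype κ] [Field k] [CommRing H] [Algebra k H]
    (l : κ → ℕ) (c : κ → k) (v : κ → H) (a : k) (h : H) :
    C (((-1) ^ (1 + ∑ j, l j) * (a * ∏ j, c j)) • (h * ∏ j, v j)) * Polynomial.X ^ (1 + ∑ j, l j) =
      -(Polynomial.X * (C (a • h) *
        ∏ j, (C (((-1) ^ l j * c j) • v j) * Polynomial.X ^ l j))) := by
  simp only [Algebra.smul_def, map_mul, map_pow, map_neg, map_one, map_prod, pow_add, pow_one,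
    Finset.prod_mul_distrib, Finset.prod_pow_eq_pow_sum]
  ring

/-- The generating polynomial `∑_T λ(T) v(T) (-t)^{l(T)}` of the trees in `ofHeight s d i`. -/
noncomputable def genPoly {k H : Type*} [Field k] [CommRing H] [Algebra k H] (lam : X → X → Multiset X → k)
    (β : X → H) (d : ℕ) (i : X) : H[X] :=
  ∑ T ∈ ofHeight s d i, C (((-1) ^ T.length * T.coeff lam) • T.value β) * Polynomial.X ^ T.length

theorem genPoly_succ {k H : Type*} [Field k] [CommRing H] [Algebra k H]
    (lam : X → X → Multiset X → k) (β : X → H) (d : ℕ) (i : X) :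
    genPoly s lam β (d + 1) i = -(Polynomial.X * (C (β i) + ∑ p ∈ s i,
      C (lam i p.1 p.2.1 • β p.1) * ∏ j : p.2.1.ToType, genPoly s lam β d j.1)) := by
  rw [genPoly, sum_ofHeight_succ, mul_add, neg_add, Finset.mul_sum, ← Finset.sum_neg_distrib]
  congr 1
  · simp only [length, coeff, value, pow_one, mul_one, neg_smul, one_smul, map_neg, neg_mul]
    rw [mul_comm]
  · refine Finset.sum_congr rfl fun p _ => ?_
    simp only [genPoly]
    classical
    -- Expanding the product chooses one tree per occurrence in `I`; as occurrences are
    -- distinguished, each tree arises exactly once.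
    rw [Finset.prod_univ_sum, Finset.mul_sum, Finset.mul_sum, ← Finset.sum_neg_distrib]
    refine Finset.sum_congr rfl fun T _ => ?_
    exact C_smul_mul_prod_mul_X_pow _ _ _ _ _

theorem coeff_genPoly {k H : Type*} [Field k] [CommRing H] [Algebra k H]
    (lam : X → X → Multiset X → k) (β : X → H) (d m : ℕ) (i : X) :
    (genPoly s lam β d i).coeff m =
      ∑ T ∈ ofHeight s d i with T.length = m, ((-1) ^ T.length * T.coeff lam) • T.value β := by
  simp only [genPoly, finsetSum_coeff, coeff_C_mul_X_pow, Finset.sum_filter]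
  exact Finset.sum_congr rfl fun T _ => if_congr eq_comm rfl rfl

/-- A family of polynomials which satisfies the recursion of the generating polynomials of trees
coincides with them up to high powers of the variable. -/
theorem X_pow_dvd_sub_genPoly {k H : Type*} [Field k] [CommRing H] [Algebra k H]
    {lam : X → X → Multiset X → k} {β : X → H} {q : X → H[X]}
    (hq : ∀ i, q i = -(Polynomial.X * (C (β i) + ∑ p ∈ s i,
      C (lam i p.1 p.2.1 • β p.1) * ∏ j : p.2.1.ToType, q j.1))) (d : ℕ) (i : X) :
    Polynomial.X ^ d ∣ q i - genPoly s lam β d i := by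
  induction d generalizing i with
  | zero => simp
  | succ d ih =>
    rw [hq, genPoly_succ, neg_sub_neg, ← mul_sub, pow_succ', add_sub_add_left_eq_sub,
      ← Finset.sum_sub_distrib]
    -- The root's factor `X` supplies the extra power, so congruence of the branches modulo `X ^ d`
    -- suffices.
    refine mul_dvd_mul_left _ (Finset.dvd_sum fun p _ => ?_)
    rw [← mul_sub]
    refine Dvd.dvd.mul_left ?_ _
    rw [← Ideal.mem_span_singleton, ← Ideal.Quotient.eq, map_prod, map_prod]
    refine Finset.prod_congr rfl fun j _ => ?_
    rw [Ideal.Quotient.eq, Ideal.mem_span_singleton, dvd_sub_comm]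
    exact ih _

end DecTree

/-! ### The reduced coproduct in the monomial basis -/

section Hopf

variable {k V H X : Type*} [Field k] [AddCommGroup V] [Module k V] [CommRing H] [DecidableEq X]

section Bialgebra

variable [Bialgebra k H] {ι : V →ₗ[k] H} (hι : IsSymmetricAlgebra ι) (b : Module.Basis X k V)

theorem monomialBasis_single (i : X) :
    monomialBasis hι b (Finsupp.single i 1) = ι (b i) := by
  simpa using monomialBasis_toFinsupp hι b {i}

theorem single_toFinsupp_injective : Function.Injective
    (fun p => (Finsupp.single p.1 1, Multiset.toFinsupp p.2.1) :
      X × {I : Multiset X // I ≠ 0} → (X →₀ ℕ) × (X →₀ ℕ)) := by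
  rintro ⟨i, I⟩ ⟨j, J⟩ h
  simp only [Prod.mk.injEq, EmbeddingLike.apply_eq_iff_eq,
    Finsupp.single_left_inj one_ne_zero] at h
  exact Prod.ext h.1 (Subtype.ext h.2)

/-- The indices of the nonzero structure coefficients of the reduced coproduct of `b i`. -/
noncomputable def structureSupport (i : X) : Finset (X × {I : Multiset X // I ≠ 0}) :=
  (((monomialBasis hι b).tensorProduct (monomialBasis hι b)).repr
    (reducedComul k H (ι (b i)))).support.preimage
    (fun p => (Finsupp.single p.1 1, Multiset.toFinsupp p.2.1)) single_toFinsupp_injective.injOn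

theorem mem_structureSupport {i i₀ : X} {I : {I : Multiset X // I ≠ 0}} :
    (i₀, I) ∈ structureSupport hι b i ↔ structureCoeff hι b i i₀ I.1 ≠ 0 := by
  exact Finset.mem_preimage.trans Finsupp.mem_support_iff

theorem counit_eq_repr_zero (hε : ∀ v, Coalgebra.counit (R := k) (ι v) = 0) (h : H) :
    Coalgebra.counit (R := k) h = (monomialBasis hι b).repr h 0 := by
  suffices Coalgebra.counit = (monomialBasis hι b).coord 0 from LinearMap.congr_fun this h
  refine (monomialBasis hι b).ext fun c => ?_
  obtain ⟨I, rfl⟩ := (Multiset.toFinsupp (α := X)).surjective c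
  rw [Module.Basis.coord_apply, Module.Basis.repr_self, monomialBasis_toFinsupp]
  rcases eq_or_ne I 0 with rfl | hI
  · simp
  · obtain ⟨j, hj⟩ := Multiset.exists_mem_of_ne_zero hI
    obtain ⟨J, rfl⟩ := Multiset.exists_cons_of_mem hj
    rw [Finsupp.single_eq_of_ne]
    · simp [hε]
    · rw [← Multiset.toFinsupp.map_zero]
      exact fun h => hI (Multiset.toFinsupp.injective h).symm

theorem lTensor_counit_reducedComul {c : H} (hc : Coalgebra.counit (R := k) c = 0) :
    (Coalgebra.counit (R := k)).lTensor H (reducedComul k H c) = 0 := by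
  simp [reducedComul, hc]

/-- The counit reads off the constant coefficient, so these coordinates are those of `(id ⊗ ε)` of
the reduced coproduct, which is zero. Hence only nonempty `I` occur. -/
theorem repr_reducedComul_zero (hε : ∀ v, Coalgebra.counit (R := k) (ι v) = 0) {c : H}
    (hc : Coalgebra.counit (R := k) c = 0) (a : X →₀ ℕ) :
    ((monomialBasis hι b).tensorProduct (monomialBasis hι b)).repr (reducedComul k H c) (a, 0)
      = 0 := by
  set B := monomialBasis hι b
  have key : ∀ z : H ⊗[k] H, (B.tensorProduct B).repr z (a, 0) =
      B.repr (TensorProduct.rid k H ((Coalgebra.counit (R := k)).lTensor H z)) a := by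
    intro z
    induction z with
    | zero => simp
    | tmul x y => simp [B, counit_eq_repr_zero hι b hε y]
    | add x y hx hy => simp [hx, hy]
  rw [key, lTensor_counit_reducedComul hc]
  simp

theorem repr_eq_zero_of_mem_range_rTensor {z : H ⊗[k] H} (hz : z ∈ LinearMap.range (ι.rTensor H))
    {a : X →₀ ℕ} (ha : ∀ i, a ≠ Finsupp.single i 1) (c : X →₀ ℕ) :
    ((monomialBasis hι b).tensorProduct (monomialBasis hι b)).repr z (a, c) = 0 := by
  obtain ⟨y, rfl⟩ := hz
  suffices (((monomialBasis hι b).tensorProduct (monomialBasis hι b)).coord (a, c)) ∘ₗ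
      ι.rTensor H = 0 from LinearMap.congr_fun this y
  refine (b.tensorProduct (monomialBasis hι b)).ext fun p => ?_
  rw [LinearMap.comp_apply, Module.Basis.tensorProduct_apply', LinearMap.rTensor_tmul,
    Module.Basis.coord_apply, Module.Basis.tensorProduct_repr_tmul_apply,
    ← monomialBasis_single hι b, Module.Basis.repr_self (monomialBasis hι b) (Finsupp.single p.1 1),
    Finsupp.single_eq_of_ne (ha p.1)]
  simp

end Bialgebra

theorem reducedComul_eq_sum [Bialgebra k H] {ι : V →ₗ[k] H} (hH : IsRightHandedPolynomial ι)
    (b : Module.Basis X k V) (i : X) :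
    reducedComul k H (ι (b i)) = ∑ p ∈ structureSupport hH.isSymmetricAlgebra b i,
      structureCoeff hH.isSymmetricAlgebra b i p.1 p.2.1 •
        (ι (b p.1) ⊗ₜ[k] (p.2.1.map fun j => ι (b j)).prod) := by
  set hι := hH.isSymmetricAlgebra
  set B := (monomialBasis hι b).tensorProduct (monomialBasis hι b)
  conv_lhs => rw [← B.linearCombination_repr (reducedComul k H (ι (b i)))]
  rw [Finsupp.linearCombination_apply, Finsupp.sum, structureSupport]
  rw [← Finset.sum_preimage (fun p : X × {I : Multiset X // I ≠ 0} =>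
    ((Finsupp.single p.1 1, Multiset.toFinsupp p.2.1) : (X →₀ ℕ) × (X →₀ ℕ)))]
  · refine Finset.sum_congr rfl fun p _ => ?_
    rw [Module.Basis.tensorProduct_apply, monomialBasis_single, monomialBasis_toFinsupp]
    rfl
  · exact single_toFinsupp_injective.injOn
  · rintro ⟨a, c⟩ hac hne
    -- An index outside the image has either a left monomial that is not a generator, excluded by
    -- right-handedness, or the right monomial `1`, excluded by the counit.
    refine absurd ?_ (Finsupp.mem_support_iff.1 hac)
    by_cases ha : ∃ i₀, a = Finsupp.single i₀ 1
    · obtain ⟨i₀, rfl⟩ := ha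
      obtain ⟨I, rfl⟩ := (Multiset.toFinsupp (α := X)).surjective c
      obtain rfl : I = 0 := by
        by_contra hI
        exact hne ⟨(i₀, ⟨I, hI⟩), rfl⟩
      rw [map_zero]
      exact repr_reducedComul_zero hι b hH.counit_ι (hH.counit_ι _) _
    · exact repr_eq_zero_of_mem_range_rTensor hι b (hH.rightHanded _) (not_exists.1 ha) c

/-! ### The antipode recursion and its scaling -/

/-- The recursion for the antipode of a right-handed polynomial Hopf algebra. -/
theorem antipode_eq_neg_sum [HopfAlgebra k H] {ι : V →ₗ[k] H} (hH : IsRightHandedPolynomial ι)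
    (b : Module.Basis X k V) (i : X) :
    HopfAlgebra.antipodeAlgHom k H (ι (b i)) =
      -(ι (b i) + ∑ p ∈ structureSupport hH.isSymmetricAlgebra b i,
        (structureCoeff hH.isSymmetricAlgebra b i p.1 p.2.1 • ι (b p.1)) *
          ∏ j : p.2.1.ToType, HopfAlgebra.antipodeAlgHom k H (ι (b j.1))) := by
  -- With `S` on the right leg, the left leg remains a single generator.
  have h := HopfAlgebra.mul_antipode_lTensor_comul_apply (R := k) (ι (b i))
  have hΔ : Coalgebra.comul (R := k) (ι (b i)) =
      reducedComul k H (ι (b i)) + ι (b i) ⊗ₜ 1 + 1 ⊗ₜ ι (b i) := by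
    simp only [reducedComul, LinearMap.sub_apply, LinearMap.flip_apply, TensorProduct.mk_apply]
    abel
  have hprod : ∀ I : Multiset X, HopfAlgebra.antipode k (I.map fun j => ι (b j)).prod =
      ∏ j : I.ToType, HopfAlgebra.antipodeAlgHom k H (ι (b j.1)) := by
    intro I
    rw [← HopfAlgebra.antipodeAlgHom_apply, map_multiset_prod, Multiset.map_map, Finset.prod,
      Multiset.map_univ I fun j => HopfAlgebra.antipodeAlgHom k H (ι (b j))]
    rfl
  rw [hΔ, reducedComul_eq_sum hH b i, hH.counit_ι] at h
  simp only [map_add, map_sum, map_smul, LinearMap.lTensor_tmul, LinearMap.mul'_apply, hprod,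
    HopfAlgebra.antipode_one, mul_one, one_mul, map_zero] at h
  simp only [smul_mul_assoc, HopfAlgebra.antipodeAlgHom_apply] at h ⊢
  linear_combination h

/-- The algebra morphism `H → H[t]` which multiplies each generator by `t`. -/
noncomputable def scaling [Algebra k H] {ι : V →ₗ[k] H} (hι : IsSymmetricAlgebra ι) :
    H →ₐ[k] H[X] :=
  hι.lift ((LinearMap.mulLeft k Polynomial.X) ∘ₗ
    (IsScalarTower.toAlgHom k H H[X]).toLinearMap ∘ₗ ι)

theorem scaling_ι [Algebra k H] {ι : V →ₗ[k] H} (hι : IsSymmetricAlgebra ι) (v : V) :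
    scaling hι (ι v) = Polynomial.X * C (ι v) := by
  simp [scaling]

theorem eval_one_scaling [Algebra k H] {ι : V →ₗ[k] H} (hι : IsSymmetricAlgebra ι) (h : H) :
    (scaling hι h).eval 1 = h := by
  have : ((Polynomial.aeval (1 : H)).restrictScalars k).comp (scaling hι) = AlgHom.id k H := by
    refine hι.algHom_ext (LinearMap.ext fun v => ?_)
    simp [scaling_ι]
  simpa [Polynomial.coe_aeval_eq_eval] using DFunLike.congr_fun this h

theorem scaling_antipode_eq [HopfAlgebra k H] {ι : V →ₗ[k] H} (hH : IsRightHandedPolynomial ι)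
    (b : Module.Basis X k V) (i : X) :
    scaling hH.isSymmetricAlgebra (HopfAlgebra.antipodeAlgHom k H (ι (b i))) =
      -(Polynomial.X * (C (ι (b i)) + ∑ p ∈ structureSupport hH.isSymmetricAlgebra b i,
        C (structureCoeff hH.isSymmetricAlgebra b i p.1 p.2.1 • ι (b p.1)) *
          ∏ j : p.2.1.ToType, scaling hH.isSymmetricAlgebra
            (HopfAlgebra.antipodeAlgHom k H (ι (b j.1))))) := by
  conv_lhs => rw [antipode_eq_neg_sum hH b i]
  simp only [map_neg, map_add, map_sum, map_mul, map_prod, ← map_smul, scaling_ι, mul_add,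
    Finset.mul_sum, mul_assoc]

/-- For large `n`, the antipode is the sum of the terms of the forest formula attached to the
trees of length at most `n`. -/
theorem exists_antipode_eq_sum [HopfAlgebra k H] {ι : V →ₗ[k] H} (hH : IsRightHandedPolynomial ι)
    (b : Module.Basis X k V) (i : X) :
    ∃ N : ℕ, ∀ n ≥ N, HopfAlgebra.antipode k (ι (b i)) =
      ∑ T ∈ DecTree.ofHeight (structureSupport hH.isSymmetricAlgebra b) (n + 1) i with T.length ≤ n,
        treeTerm hH.isSymmetricAlgebra b T := by
  set hι := hH.isSymmetricAlgebra
  set q : X → H[X] := fun i => scaling hι (HopfAlgebra.antipodeAlgHom k H (ι (b i))) with hq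
  refine ⟨(q i).natDegree, fun n hn => ?_⟩
  -- Height `n + 1` gives agreement of the coefficients `0, …, n`, which are all those of `q i`.
  have hdvd := DecTree.X_pow_dvd_sub_genPoly _ (scaling_antipode_eq hH b) (n + 1) i
  rw [Polynomial.X_pow_dvd_iff] at hdvd
  calc HopfAlgebra.antipode k (ι (b i)) = (q i).eval 1 := by
        rw [hq, eval_one_scaling, HopfAlgebra.antipodeAlgHom_apply]
    _ = ∑ m ∈ Finset.range (n + 1), (q i).coeff m := by
        simp [Polynomial.eval_eq_sum_range' (Nat.lt_succ_of_le hn)]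
    _ = ∑ m ∈ Finset.range (n + 1),
          ∑ T ∈ DecTree.ofHeight (structureSupport hι b) (n + 1) i with T.length = m,
            treeTerm hι b T := by
        refine Finset.sum_congr rfl fun m hm => ?_
        have := hdvd m (Finset.mem_range.1 hm)
        rw [Polynomial.coeff_sub, sub_eq_zero, DecTree.coeff_genPoly] at this
        exact this
    _ = _ := by
        rw [← Finset.sum_fiberwise_of_maps_to (s := Finset.filter _ _) (t := Finset.range (n + 1))
          (g := DecTree.length)]
        · refine Finset.sum_congr rfl fun m hm => ?_
          rw [Finset.filter_filter]
          refine Finset.sum_congr (Finset.filter_congr fun T _ => ?_) fun _ _ => rfl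
          have := Finset.mem_range.1 hm
          omega
        · intro T hT
          have := (Finset.mem_filter.1 hT).2
          exact Finset.mem_range.2 (by omega)

end Hopf

end PreLieForest

/-! ### The four assertions -/

theorem mainTheorem1 {k V H X : Type*} [Field k] [CharZero k] [AddCommGroup V] [Module k V]
    [CommRing H] [HopfAlgebra k H] [DecidableEq X] (ι : V →ₗ[k] H)
    (hH : PreLieForest.IsRightHandedPolynomial ι) (hc : PreLieForest.IsConilpotent k H)
    (b : Module.Basis X k V) (i : X) :
    -- in each length only finitely many trees contribute
    (∀ n : ℕ, {T : PreLieForest.DecTree X i | T.length ≤ n ∧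
        PreLieForest.treeCoeff hH.isSymmetricAlgebra b T ≠ 0}.Finite) ∧
    -- the sum over all trees, taken by increasing length, is stationary and equal to `S(b_i)`
    (∃ N : ℕ, ∀ n ≥ N, HopfAlgebra.antipode k (ι (b i)) =
      ∑ᶠ (T : PreLieForest.DecTree X i) (_ : T.length ≤ n),
        PreLieForest.treeTerm hH.isSymmetricAlgebra b T) ∧
    -- it is an ordinary finite sum as soon as only finitely many `λ(T)` are nonzero
    ({T : PreLieForest.DecTree X i |
        PreLieForest.treeCoeff hH.isSymmetricAlgebra b T ≠ 0}.Finite →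
      HopfAlgebra.antipode k (ι (b i)) =
        ∑ᶠ T : PreLieForest.DecTree X i, PreLieForest.treeTerm hH.isSymmetricAlgebra b T) ∧
    -- which is the case for instance when the basis is graded by positive degrees
    (∀ deg : X → ℕ,
      (∀ (p p₀ : X) (I : Multiset X),
        PreLieForest.structureCoeff hH.isSymmetricAlgebra b p p₀ I ≠ 0 →
          ∀ j ∈ I, deg j < deg p) →
      {T : PreLieForest.DecTree X i |
        PreLieForest.treeCoeff hH.isSymmetricAlgebra b T ≠ 0}.Finite) := by
  set hι := hH.isSymmetricAlgebra
  have hs : ∀ i i₀ (I : {I : Multiset X // I ≠ 0}),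
      PreLieForest.structureCoeff hι b i i₀ I.1 ≠ 0 →
        (i₀, I) ∈ PreLieForest.structureSupport hι b i :=
    fun _ _ _ => (PreLieForest.mem_structureSupport hι b).2
  have hterm : ∀ T : PreLieForest.DecTree X i, PreLieForest.treeTerm hι b T ≠ 0 →
      PreLieForest.treeCoeff hι b T ≠ 0 := fun T hT h => hT (by simp [PreLieForest.treeTerm, h])
  have hsum : ∃ N : ℕ, ∀ n ≥ N, HopfAlgebra.antipode k (ι (b i)) =
      ∑ᶠ (T : PreLieForest.DecTree X i) (_ : T.length ≤ n), PreLieForest.treeTerm hι b T := by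
    obtain ⟨N, hN⟩ := PreLieForest.exists_antipode_eq_sum hH b i
    refine ⟨N, fun n hn => (hN n hn).trans (finsum_cond_eq_sum_of_cond_iff _ fun {T} hT => ?_).symm⟩
    rw [Finset.mem_filter, iff_and_self]
    exact fun h => T.mem_ofHeight_of_length_le hs (hterm T hT) (h.trans n.le_succ)
  refine ⟨fun n => ?_, hsum, fun hfin => ?_, fun deg hdeg => ?_⟩
  · exact (PreLieForest.DecTree.ofHeight (PreLieForest.structureSupport hι b) n i).finite_toSet.subset
      fun T hT => T.mem_ofHeight_of_length_le hs hT.2 hT.1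
  · obtain ⟨N, hN⟩ := hsum
    obtain ⟨M, hM⟩ := (hfin.image PreLieForest.DecTree.length).bddAbove
    -- `M` bounds the lengths of contributing trees, so the length condition is vacuous on nonzero
    -- terms.
    rw [hN (max N M) (le_max_left _ _)]
    refine finsum_congr fun T => ?_
    by_cases hT : PreLieForest.treeTerm hι b T = 0
    · simp [hT]
    · exact finsum_eq_if.trans
        (if_pos ((hM (Set.mem_image_of_mem _ (hterm T hT))).trans (le_max_right _ _)))
  · exact (PreLieForest.DecTree.ofHeight (PreLieForest.structureSupport hι b)
      (deg i + 1) i).finite_toSet.subset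
        fun T hT => T.mem_ofHeight_of_deg_lt hs hdeg hT (Nat.lt_succ_self _)
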